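/- Let $n\ge 1$ and let $H_0=\{x\in\mathbb R^{n+1}:\sum_i x_i=0\}$. A multigraph here is an undirected multigraph without self-loops on the labelled vertices $0,\dots,n$, identified with its edge multiplicities. For a connected multigraph $G$ with Laplacian matrix $Q(G)=D(G)-A(G)$ and rows $b_0,\dots,b_n\in H_0$, the Laplacian lattice $L_G$ is the subgroup of $H_0$ generated by $b_0,\dots,b_n$. Let $N_{Gr}(L)$ be the number of connected multigraphs on $0,\dots,n$ whose Laplacian lattice is $L$. Let $\triangle\subset H_0$ be the regular simplex with vertices $t_0,\dots,t_n$, where $t_i$ has $i$-th coordinate $n$ and all other coordinates $-1$. For $p\in H_0$ and $\lambda\ge0$ put $\triangle(p,\lambda)=p+\lambda\triangle$, and put $d_\triangle(p,q)=\inf\{\lambda\ge 0: q\in \triangle(p,\lambda)\}$. For a discrete set $S\subset H_0$ let $h_{S}(p)=\min_{q\in S}d_\triangle(p,q)$. A triangulation of $S$ is a locally finite simplicial complex in $H_0$ with vertex set $S$ that covers the convex hull of $S$. It is a Delaunay triangulation of $S$ under $d_\triangle$ if for every local maximum $c$ of $h_{S}$ on $H_0$ it has an $n$-dimensional simplex all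 of whose vertices lie on the boundary (in $H_0$) of $\triangle(c,h_{S}(c))$. For a triangulation $T$ having the origin $O$ as a vertex, let $H_T(O)$ be the union of the simplices of $T$ that have $O$ as a vertex; two triangulations $T_1,T_2$ are regarded as the same if $H_{T_1}(O)=H_{T_2}(O)$, and as different otherwise. Let $N_{Del}(L_G,\triangle)$ be the (possibly infinite) number of different Delaunay triangulations of $L_G$ under $d_\triangle$. For a permutation $\sigma$ of $\{0,\dots,n\}$ let $u^\sigma_i=\sum_{j=0}^{i}b_{\sigma(j)}$ for $0\le i\le n$, and let $Del(G)$ be the collection of the simplices with vertices $u^\sigma_0+p,\dots,u^\sigma_n+p$, for all permutations $\sigma$ and all $p\in L_G$, together with their faces. Then the following hold. 1. For every connected multigraph $G$, $Del(G)$ is a Delaunay triangulation of $L_G$ under $d_\triangle$. 2. For all connected multigraphs $G_1,G_2$ on $0,\dots,n$, $H_{Del(G_1)}(O)=H_{Del(G_2)}(O)$ if and only if $Q(G_1)=Q(G_2)$. 3. For every connected multigraph $G$, $N_{Gr}(L_G)\le N_{Del}(L_G,\triangle)$. -/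

import Mathlib

open scoped Pointwise

noncomputable section

namespace LaplacianLattice

section Polyhedral

variable {E : Type*} [NormedAddCommGroup E] [NormedSpace ℝ E]

/-- The dilated and translated copy `P(p, r) = p + r • P` of `P`. -/
def dilate (P : Set E) (p : E) (r : ℝ) : Set E := p +ᵥ (r • P)

/-- The polyhedral distance function `d_P(p, q) = inf {r ≥ 0 | q ∈ P(p, r)}`. -/
def polyDist (P : Set E) (p q : E) : ℝ := sInf {r : ℝ | 0 ≤ r ∧ q ∈ dilate P p r}

/-- The function `h_{P,S}(p) = min {d_P(p, q) | q ∈ S}`. -/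
def distToSet (P S : Set E) (p : E) : ℝ := ⨅ q : S, polyDist P p q

/-- The set of local maxima of `h_{P,S}`. -/
def crit (P S : Set E) : Set E := {c | IsLocalMax (distToSet P S) c}

/-- `T` is a triangulation of the point set `S`: a locally finite simplicial complex with
vertex set `S` that covers the convex hull of `S`. -/
structure IsTriangulation (S : Set E) (T : Geometry.SimplicialComplex ℝ E) : Prop where
  vertices_eq : T.vertices = S
  space_eq : T.space = convexHull ℝ S
  locallyFinite : LocallyFinite fun s : T.faces => convexHull ℝ ((s : Finset E) : Set E)

/-- `T` is a Delaunay triangulation of `S` under `d_P`: every local maximum `c` of `h_{P,S}` has a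
full-dimensional simplex of `T` all of whose vertices lie on the boundary of `P(c, h_{P,S}(c))`. -/
structure IsDelaunay (P S : Set E) (T : Geometry.SimplicialComplex ℝ E) : Prop
    extends IsTriangulation S T where
  exists_simplex : ∀ c ∈ crit P S, ∃ s ∈ T.faces, s.card = Module.finrank ℝ E + 1 ∧
    (s : Set E) ⊆ frontier (dilate P c (distToSet P S c))

/-- The union of those simplices of a family (given by their vertex sets) that have the origin
as a vertex. -/
def originStar (F : Set (Finset E)) : Set E :=
  ⋃ s ∈ {s ∈ F | (0 : E) ∈ s}, convexHull ℝ (s : Set E)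

/-- The number of different Delaunay triangulations of `S` under `d_P`; two triangulations are
the same if the unions of their simplices at the origin are equal. -/
def numDelaunay (P S : Set E) : ℕ∞ :=
  Set.encard {H : Set E | ∃ T : Geometry.SimplicialComplex ℝ E,
    IsDelaunay P S T ∧ H = originStar T.faces}

end Polyhedral

/-- The hyperplane `H₀` of vectors in `ℝ^(n+1)` whose coordinates sum to zero. -/
def H0 (n : ℕ) : Submodule ℝ (Fin (n + 1) → ℝ) where
  carrier := {x | ∑ i, x i = 0}
  zero_mem' := by simp
  add_mem' := by
    intro x y hx hy
    simp only [Set.mem_ofPred_eq] at hx hy ⊢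
    simp [Finset.sum_add_distrib, hx, hy]
  smul_mem' := by
    intro r x hx
    simp only [Set.mem_ofPred_eq] at hx ⊢
    simp [← Finset.mul_sum, hx]

/-- The vertex `t_i` of the regular simplex: coordinate `i` is `n`, all others are `-1`. -/
def simplexVertex (n : ℕ) (i : Fin (n + 1)) : H0 n :=
  ⟨fun j => if j = i then (n : ℝ) else -1, by
    change ∑ j, (if j = i then (n : ℝ) else -1) = 0
    have h : ∀ j : Fin (n + 1), (if j = i then (n : ℝ) else -1)
        = (if j = i then (n : ℝ) + 1 else 0) + -1 := by
      intro j; split_ifs <;> ring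
    simp [h, Finset.sum_add_distrib]⟩

/-- The regular simplex `△`, the convex hull of `t_0, …, t_n` in `H₀`. -/
def regularSimplex (n : ℕ) : Set (H0 n) := convexHull ℝ (Set.range (simplexVertex n))

/-- A labelled undirected multigraph without self-loops on the vertices `0, …, n`, given by the
numbers `mult i j` of edges between `i` and `j`. -/
@[ext]
structure Multigraph (n : ℕ) where
  mult : Fin (n + 1) → Fin (n + 1) → ℕ
  symm : ∀ i j, mult i j = mult j i
  loopless : ∀ i, mult i i = 0

namespace Multigraph

variable {n : ℕ}

/-- The simple graph in which two vertices are adjacent if some edge joins them. -/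
def support (G : Multigraph n) : SimpleGraph (Fin (n + 1)) where
  Adj i j := 0 < G.mult i j
  symm := ⟨fun i j h => by rw [G.symm]; exact h⟩
  loopless := ⟨fun i h => by simp [G.loopless] at h⟩

/-- A multigraph is connected if any two vertices are joined by a path. -/
def Connected (G : Multigraph n) : Prop := G.support.Connected

/-- The Laplacian matrix `Q(G) = D(G) - A(G)`. -/
def laplacian (G : Multigraph n) : Matrix (Fin (n + 1)) (Fin (n + 1)) ℤ :=
  Matrix.diagonal (fun i => ∑ j, (G.mult i j : ℤ)) - Matrix.of fun i j => (G.mult i j : ℤ)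

/-- The `i`-th row `b_i` of the Laplacian matrix, as a vector of `H₀`. -/
def row (G : Multigraph n) (i : Fin (n + 1)) : H0 n :=
  ⟨fun j => (G.laplacian i j : ℝ), by
    change ∑ j, (G.laplacian i j : ℝ) = 0
    have h : ∑ j, G.laplacian i j = 0 := by
      simp [laplacian, Matrix.diagonal_apply, Finset.sum_sub_distrib]
    exact_mod_cast h⟩

/-- The Laplacian lattice `L_G`, generated by the rows of the Laplacian matrix. -/
def lattice (G : Multigraph n) : AddSubgroup (H0 n) := AddSubgroup.closure (Set.range G.row)

/-- `u^σ_i = b_{σ(0)} + ⋯ + b_{σ(i)}`. -/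
def partialSum (G : Multigraph n) (σ : Equiv.Perm (Fin (n + 1))) (i : Fin (n + 1)) : H0 n :=
  ∑ j ∈ Finset.Iic i, G.row (σ j)

/-- The vertex sets of all simplices of `Del(G)`: the nonempty subsets of the sets
`{u^σ_0 + p, …, u^σ_n + p}`, where `σ` is a permutation and `p ∈ L_G`. -/
def delFaces (G : Multigraph n) : Set (Finset (H0 n)) :=
  {s | s.Nonempty ∧ ∃ σ : Equiv.Perm (Fin (n + 1)), ∃ p ∈ G.lattice,
    (s : Set (H0 n)) ⊆ Set.range fun i => G.partialSum σ i + p}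

end Multigraph

/-- `N_Gr(L)`: the number of connected multigraphs on `0, …, n` with Laplacian lattice `L`. -/
def numGraphs {n : ℕ} (L : AddSubgroup (H0 n)) : ℕ∞ :=
  Set.encard {G : Multigraph n | G.Connected ∧ G.lattice = L}

end LaplacianLattice

end

namespace LaplacianLattice

/-! The map `combo`, `f ↦ ∑ f_i b_i`, has the constants as kernel when `G` is connected. It
therefore identifies `H0 n` with `ℝ^(n+1)` modulo constants, and `L_G` with the image of `ℤ^(n+1)`.

In this picture the simplices of `Del(G)` record the order of the fractional parts of `f`, and
sorting these parts shows that they cover. Rounding down all lifts `f` of a point `x` gives a set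
`carrier x` that depends on `x` alone. By `carrier_eq` it consists of the vertices with positive
weight in any simplex containing `x`, so simplices meet along common faces.

For the Delaunay condition, `d_△(c,q) = max_i (c_i - q_i)`. With `r = h(c)`, no lattice point
strictly dominates `c - r·1` in all coordinates. Dhar's burning argument places a point `q - ν^σ`
below `c - r·1`, where `ν^σ` counts at each vertex the edges to earlier vertices in the order `σ`.
No lattice point strictly dominates `q - ν^σ` either, so a strict inequality somewhere would let `c`
move so as to increase `h`. At a local maximum the two points agree, and the simplex of `σ`
translated by `q` lies on the boundary of `△(c,r)`.

The star of `O` in `Del(G)` is the image of the cube `[0,1]^(n+1)` under `combo`. Its maximal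
coordinates are the degrees, and its maximal sums of two coordinates are `deg v + deg w - 2 mult v
w`. Hence the star determines `G`, and `G' ↦ originStar G'.delFaces` is an injection that gives the
counting inequality. -/

theorem H0.sum_coe_eq_zero {n : ℕ} (x : H0 n) : ∑ i, (x : Fin (n + 1) → ℝ) i = 0 := x.2

theorem H0.ext_coe {n : ℕ} {x y : H0 n}
    (h : ∀ i, (x : Fin (n + 1) → ℝ) i = (y : Fin (n + 1) → ℝ) i) : x = y :=
  Subtype.ext (funext h)

theorem H0.finrank_eq (n : ℕ) : Module.finrank ℝ (H0 n) = n := by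
  let φ : Module.Dual ℝ (Fin (n + 1) → ℝ) := ∑ i, LinearMap.proj i
  have hφ : ∀ x, φ x = ∑ i, x i := fun x => by simp [φ]
  have hker : LinearMap.ker φ = H0 n := by
    ext x
    rw [LinearMap.mem_ker, hφ]
    rfl
  have hne : φ ≠ 0 := by
    intro h
    have h1 : φ (Pi.single 0 1) = 0 := by rw [h]; rfl
    rw [hφ] at h1
    simp at h1
  have h := Module.Dual.finrank_ker_add_one_of_ne_zero hne
  rw [hker] at h
  simpa using h

/-! ### The Laplacian as a linear map and its kernel -/

namespace Multigraph

variable {n : ℕ} (G : Multigraph n)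

/-- The linear map `f ↦ ∑ f_i b_i`. -/
noncomputable def combo : (Fin (n + 1) → ℝ) →ₗ[ℝ] H0 n := Fintype.linearCombination ℝ G.row

theorem combo_eq_sum (f : Fin (n + 1) → ℝ) : G.combo f = ∑ i, f i • G.row i :=
  Fintype.linearCombination_apply _ _ _

theorem row_apply (i j : Fin (n + 1)) : (G.row i : Fin (n + 1) → ℝ) j =
    (if i = j then ∑ k, (G.mult i k : ℝ) else 0) - G.mult i j := by
  simp only [row, laplacian, Matrix.sub_apply, Matrix.diagonal_apply, Matrix.of_apply]
  split_ifs <;> simp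

theorem combo_apply (f : Fin (n + 1) → ℝ) (v : Fin (n + 1)) :
    (G.combo f : Fin (n + 1) → ℝ) v = ∑ w, (G.mult w v : ℝ) * (f v - f w) := by
  rw [combo_eq_sum, AddSubmonoidClass.coe_finsetSum, Finset.sum_apply]
  simp only [Submodule.coe_smul, Pi.smul_apply, row_apply, smul_eq_mul, mul_sub,
    Finset.sum_sub_distrib, mul_ite, mul_zero, Finset.sum_ite_eq', Finset.mem_univ, if_true]
  rw [mul_comm, Finset.sum_mul]
  simp only [G.symm v, mul_comm (f _)]

theorem combo_const (c : ℝ) : G.combo (fun _ => c) = 0 :=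
  H0.ext_coe fun v => by simp [combo_apply]

theorem combo_add_const (f : Fin (n + 1) → ℝ) (c : ℝ) : G.combo (fun v => f v + c) = G.combo f := by
  have : (fun v => f v + c) = f + fun _ => c := rfl
  rw [this, map_add, combo_const, add_zero]

theorem mem_lattice_iff {q : H0 n} :
    q ∈ G.lattice ↔ ∃ f : Fin (n + 1) → ℤ, q = G.combo fun v => (f v : ℝ) := by
  rw [lattice, AddSubgroup.mem_closure_range_iff_of_fintype]
  refine exists_congr fun f => ?_
  rw [combo_eq_sum, Finset.sum_congr rfl fun i _ => Int.cast_smul_eq_zsmul ℝ (f i) (G.row i)]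

theorem exists_int_eq_of_mem_lattice {q : H0 n} (hq : q ∈ G.lattice) :
    ∃ z : Fin (n + 1) → ℤ, ∀ v, (q : Fin (n + 1) → ℝ) v = z v := by
  obtain ⟨f, rfl⟩ := G.mem_lattice_iff.1 hq
  refine ⟨fun v => ∑ w, (G.mult w v : ℤ) * (f v - f w), fun v => ?_⟩
  rw [combo_apply]
  push_cast
  rfl

theorem partialSum_eq_combo (σ : Equiv.Perm (Fin (n + 1))) (i : Fin (n + 1)) :
    G.partialSum σ i = G.combo fun v => if σ.symm v ≤ i then 1 else 0 := by
  rw [combo_eq_sum, ← Equiv.sum_comp σ]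
  simp only [Equiv.symm_apply_apply, ite_smul, one_smul, zero_smul]
  rw [← Finset.sum_filter, partialSum]
  exact Finset.sum_congr (by ext; simp) fun _ _ => rfl

theorem partialSum_mem_lattice (σ : Equiv.Perm (Fin (n + 1))) (i : Fin (n + 1)) :
    G.partialSum σ i ∈ G.lattice :=
  sum_mem fun _ _ => AddSubgroup.subset_closure ⟨_, rfl⟩

theorem partialSum_last (σ : Equiv.Perm (Fin (n + 1))) : G.partialSum σ (Fin.last n) = 0 := by
  rw [partialSum_eq_combo]
  simpa [Fin.le_last] using G.combo_const 1

theorem sum_smul_partialSum (σ : Equiv.Perm (Fin (n + 1))) (w : Fin (n + 1) → ℝ) :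
    ∑ i, w i • G.partialSum σ i = G.combo fun v => ∑ i ∈ Finset.Ici (σ.symm v), w i := by
  simp only [partialSum_eq_combo, ← map_smul, ← map_sum]
  congr 1
  ext v
  simp only [Finset.sum_apply, Pi.smul_apply, smul_eq_mul, mul_ite, mul_one, mul_zero]
  rw [← Finset.sum_filter]
  exact Finset.sum_congr (by ext; simp) fun _ _ => rfl

variable {G}

/-- Minimum principle for the graph Laplacian. -/
theorem Connected.le_of_combo_nonneg (hG : G.Connected) {f : Fin (n + 1) → ℝ} {a : Fin (n + 1)}
    (h : ∀ v, v ≠ a → 0 ≤ (G.combo f : Fin (n + 1) → ℝ) v) (v : Fin (n + 1)) : f a ≤ f v := by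
  obtain ⟨b, hb⟩ := Finite.exists_min f
  suffices h' : ∀ u w, G.support.Walk u w → w = a → f u = f b → f a = f b by
    obtain ⟨p⟩ := hG.preconnected b a
    exact (h' b a p rfl rfl).trans_le (hb v)
  -- Minimality propagates along the walk: at a minimizer other than `a`, a nonnegative sum of
  -- nonpositive terms vanishes, so every neighbour is a minimizer too.
  intro u w p
  induction p with
  | nil => intro h1 h2; rwa [h1] at h2
  | @cons u u' w hadj p ih =>
    intro hw hu
    by_cases hua : u = a
    · rw [← hua, hu]
    refine ih hw ?_
    have hnp : ∀ x ∈ Finset.univ, (G.mult x u : ℝ) * (f u - f x) ≤ 0 := fun x _ =>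
      mul_nonpos_of_nonneg_of_nonpos (Nat.cast_nonneg _) (by linarith [hb x])
    have h0 : ∑ x, (G.mult x u : ℝ) * (f u - f x) = 0 :=
      le_antisymm (Finset.sum_nonpos hnp) (by rw [← combo_apply]; exact h u hua)
    have h1 := (Finset.sum_eq_zero_iff_of_nonpos hnp).1 h0 u' (Finset.mem_univ _)
    have h2 : (G.mult u' u : ℝ) ≠ 0 := by
      rw [G.symm]
      exact Nat.cast_ne_zero.2 (Nat.pos_iff_ne_zero.1 hadj)
    have h3 := (mul_eq_zero.1 h1).resolve_left h2
    linarith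

theorem Connected.eq_of_combo_eq_zero (hG : G.Connected) {f : Fin (n + 1) → ℝ}
    (h : G.combo f = 0) (v w : Fin (n + 1)) : f v = f w :=
  le_antisymm (hG.le_of_combo_nonneg (by simp [h]) _) (hG.le_of_combo_nonneg (by simp [h]) _)

theorem Connected.exists_eq_add_of_combo_eq (hG : G.Connected) {f g : Fin (n + 1) → ℝ}
    (h : G.combo f = G.combo g) : ∃ c, ∀ v, f v = g v + c := by
  refine ⟨f 0 - g 0, fun v => ?_⟩
  have := hG.eq_of_combo_eq_zero (f := f - g) (by rw [map_sub, h, sub_self]) v 0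
  simp only [Pi.sub_apply] at this
  linarith

/-- Rank-nullity: the kernel has dimension at most 1, so the rank is at least `n`, the dimension of
`H0 n`. -/
theorem Connected.combo_surjective (hG : G.Connected) : Function.Surjective G.combo := by
  have hker : LinearMap.ker G.combo ≤ Submodule.span ℝ {fun _ => 1} := by
    intro f hf
    rw [Submodule.mem_span_singleton]
    refine ⟨f 0, funext fun v => ?_⟩
    simpa using hG.eq_of_combo_eq_zero hf 0 v
  have h1 : Module.finrank ℝ (LinearMap.ker G.combo) ≤ 1 :=
    (Submodule.finrank_mono hker).trans (finrank_span_singleton fun h => one_ne_zero (congrFun h 0)).le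
  have h2 := G.combo.finrank_range_add_finrank_ker
  rw [Module.finrank_fin_fun] at h2
  rw [← LinearMap.range_eq_top]
  apply Submodule.eq_top_of_finrank_eq
  apply le_antisymm (Submodule.finrank_le _)
  rw [H0.finrank_eq]
  omega

end Multigraph


/-! ### Tail sums of barycentric weights -/

section Tail

variable {n : ℕ} (w : Fin (n + 1) → ℝ)

theorem sum_Ici_eq_add_sum_Ioi (j : Fin (n + 1)) :
    ∑ i ∈ Finset.Ici j, w i = w j + ∑ i ∈ Finset.Ioi j, w i := by
  rw [← Finset.Ioi_insert, Finset.sum_insert (by simp)]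

theorem Ioi_eq_empty_or_eq_Ici (j : Fin (n + 1)) :
    Finset.Ioi j = ∅ ∨ ∃ k, j < k ∧ Finset.Ioi j = Finset.Ici k := by
  refine (Finset.Ioi j).eq_empty_or_nonempty.imp id fun h => ?_
  have hk := Finset.min'_mem _ h
  refine ⟨(Finset.Ioi j).min' h, Finset.mem_Ioi.1 hk, ?_⟩
  ext i
  simp only [Finset.mem_Ici]
  exact ⟨Finset.min'_le _ _, fun hi => Finset.mem_Ioi.2 ((Finset.mem_Ioi.1 hk).trans_le hi)⟩

theorem sum_Ici_zero : ∑ i ∈ Finset.Ici (0 : Fin (n + 1)), w i = ∑ i, w i :=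
  Finset.sum_congr (by ext; simp) fun _ _ => rfl

variable {w}

theorem sum_Ici_anti (hw : ∀ i, 0 ≤ w i) {j k : Fin (n + 1)} (h : j ≤ k) :
    ∑ i ∈ Finset.Ici k, w i ≤ ∑ i ∈ Finset.Ici j, w i :=
  Finset.sum_le_sum_of_subset_of_nonneg (Finset.Ici_subset_Ici.2 h) fun i _ _ => hw i

theorem sum_Ici_lt (hw : ∀ i, 0 ≤ w i) {j k : Fin (n + 1)} (h : j < k) (hj : 0 < w j) :
    ∑ i ∈ Finset.Ici k, w i < ∑ i ∈ Finset.Ici j, w i := by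
  rw [sum_Ici_eq_add_sum_Ioi w j]
  have : ∑ i ∈ Finset.Ici k, w i ≤ ∑ i ∈ Finset.Ioi j, w i :=
    Finset.sum_le_sum_of_subset_of_nonneg
      (fun i hi => Finset.mem_Ioi.2 (h.trans_le (Finset.mem_Ici.1 hi))) fun i _ _ => hw i
  linarith

theorem eq_zero_of_sum_Ici_eq_zero (h : ∀ j, ∑ i ∈ Finset.Ici j, w i = 0) (j : Fin (n + 1)) :
    w j = 0 := by
  have h1 := sum_Ici_eq_add_sum_Ioi w j
  rcases Ioi_eq_empty_or_eq_Ici j with h2 | ⟨k, -, h2⟩ <;> rw [h, h2] at h1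
  · simpa using h1.symm
  · rw [h] at h1
    simpa using h1.symm

/-- Tail sums decrease in `j`, so a superlevel set is an initial segment. Its last index carries
positive weight, as otherwise the next tail would be just as large. -/
theorem exists_forall_le_sum_Ici_iff (hw : ∀ i, 0 ≤ w i) {θ : ℝ} (hθ : 0 < θ)
    (hθ' : θ ≤ ∑ i, w i) : ∃ i, 0 < w i ∧ ∀ j, θ ≤ ∑ k ∈ Finset.Ici j, w k ↔ j ≤ i := by
  let A : Finset (Fin (n + 1)) := {j | θ ≤ ∑ k ∈ Finset.Ici j, w k}
  have hA : ∀ j, j ∈ A ↔ θ ≤ ∑ k ∈ Finset.Ici j, w k := fun j => by simp [A]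
  have hne : A.Nonempty := ⟨0, by rwa [hA, sum_Ici_zero]⟩
  set i := A.max' hne with hi
  have hiA : i ∈ A := Finset.max'_mem _ _
  refine ⟨i, ?_, fun j => ⟨fun h => Finset.le_max' _ _ ((hA j).2 h),
    fun h => ((hA i).1 hiA).trans (sum_Ici_anti hw h)⟩⟩
  by_contra hwi
  have h0 : w i = 0 := le_antisymm (not_lt.1 hwi) (hw i)
  have h1 := (hA i).1 hiA
  rw [sum_Ici_eq_add_sum_Ioi, h0, zero_add] at h1
  rcases Ioi_eq_empty_or_eq_Ici i with h2 | ⟨k, hk, h2⟩ <;> rw [h2] at h1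
  · simp at h1
    linarith
  · exact absurd (Finset.le_max' _ _ ((hA k).2 h1)) (not_le.2 hk)

theorem sum_Ici_telescope (g : ℕ → ℝ) (j : Fin (n + 1)) :
    ∑ i ∈ Finset.Ici j, (g i - g (i + 1)) = g j - g (n + 1) := by
  have h : ∀ N, ∑ k ∈ Finset.range N, (if (j : ℕ) ≤ k then g k - g (k + 1) else 0) =
      if (j : ℕ) ≤ N then g j - g N else 0 := by
    intro N
    induction N with
    | zero =>
      by_cases hj : (j : ℕ) = 0 <;> simp [hj]
    | succ N ih =>
      rw [Finset.sum_range_succ, ih]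
      rcases lt_trichotomy (j : ℕ) (N + 1) with h | h | h
      · rw [if_pos (by omega), if_pos (by omega), if_pos (by omega)]
        ring
      · rw [if_neg (by omega), if_neg (by omega), if_pos (by omega), h]
        ring
      · rw [if_neg (by omega), if_neg (by omega), if_neg (by omega), add_zero]
  have h1 := h (n + 1)
  rw [if_pos (by omega), ← Fin.sum_univ_eq_sum_range
    (fun k => if (j : ℕ) ≤ k then g k - g (k + 1) else 0)] at h1
  rw [← h1, ← Finset.sum_filter]
  refine Finset.sum_congr ?_ fun _ _ => rfl
  ext i
  rw [Finset.mem_Ici, Finset.mem_filter, Fin.le_def, and_iff_right (Finset.mem_univ i)]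

end Tail

theorem sum_ite_mem_eq_sum {ι E M : Type*} [Fintype ι] [DecidableEq E] [AddCommMonoid M]
    {g : ι → E} (hg : Function.Injective g) {s : Finset E} (hs : (s : Set E) ⊆ Set.range g)
    (F : E → M) : ∑ i, (if g i ∈ s then F (g i) else 0) = ∑ y ∈ s, F y := by
  rw [← Finset.sum_filter, ← Finset.sum_image (f := F) (g := g) fun _ _ _ _ h => hg h]
  refine Finset.sum_congr ?_ fun _ _ => rfl
  ext y
  simp only [Finset.mem_image, Finset.mem_filter, Finset.mem_univ, true_and]
  constructor
  · rintro ⟨i, hi, rfl⟩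
    exact hi
  · intro hy
    obtain ⟨i, rfl⟩ := hs hy
    exact ⟨i, hy, rfl⟩

/-! ### `Del(G)` is a triangulation of the lattice -/

namespace Multigraph

variable {n : ℕ} (G : Multigraph n)

/-- The vertices of the minimal simplex of `Del(G)` that contains `x`. -/
def carrier (x : H0 n) : Set (H0 n) :=
  {y | ∃ f : Fin (n + 1) → ℝ, G.combo f = x ∧ y = G.combo fun v => (⌊f v⌋ : ℝ)}

theorem sum_smul_partialSum_add (σ : Equiv.Perm (Fin (n + 1))) {w : Fin (n + 1) → ℝ}
    (hw1 : ∑ i, w i = 1) (f : Fin (n + 1) → ℝ) :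
    ∑ i, w i • (G.partialSum σ i + G.combo f) =
      G.combo fun v => f v + ∑ i ∈ Finset.Ici (σ.symm v), w i := by
  simp only [smul_add, Finset.sum_add_distrib]
  rw [sum_smul_partialSum, ← Finset.sum_smul, hw1, one_smul, ← map_add]
  congr 1
  ext v
  exact add_comm _ _

theorem floor_add_add_eq {m : ℤ} {s t : ℝ} (hs0 : 0 ≤ s) (hs1 : s ≤ 1) (ht0 : 0 ≤ t)
    (ht1 : t < 1) : ⌊(m : ℝ) + s + t⌋ = m + if 1 - t ≤ s then 1 else 0 := by
  rw [add_assoc, Int.floor_intCast_add]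
  congr 1
  split_ifs with h <;> rw [Int.floor_eq_iff] <;> push_cast <;> constructor <;> linarith

variable {G}

/-- The lifts of the point are `f₀` plus tail sums plus a constant `c`. With `t` the fractional part
of `c`, rounding down adds 1 exactly where the tail sum reaches `1 - t`. This is an initial segment
of the order `σ`, so a vertex `u^σ_i + p` results. -/
theorem Connected.carrier_eq (hG : G.Connected) (σ : Equiv.Perm (Fin (n + 1))) {p : H0 n}
    (hp : p ∈ G.lattice) {w : Fin (n + 1) → ℝ} (hw : ∀ i, 0 ≤ w i) (hw1 : ∑ i, w i = 1) :
    G.carrier (∑ i, w i • (G.partialSum σ i + p)) =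
      {y | ∃ i, 0 < w i ∧ y = G.partialSum σ i + p} := by
  obtain ⟨f₀, rfl⟩ := G.mem_lattice_iff.1 hp
  rw [G.sum_smul_partialSum_add σ hw1]
  have hs0 : ∀ j, 0 ≤ ∑ i ∈ Finset.Ici j, w i := fun j => Finset.sum_nonneg fun i _ => hw i
  have hs1 : ∀ j, ∑ i ∈ Finset.Ici j, w i ≤ 1 := fun j => by
    rw [← hw1, ← sum_Ici_zero]
    exact sum_Ici_anti hw (Fin.zero_le j)
  have key : ∀ t i, 0 ≤ t → t < 1 → (∀ j, 1 - t ≤ ∑ k ∈ Finset.Ici j, w k ↔ j ≤ i) →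
      (G.combo fun v => (⌊(f₀ v : ℝ) + ∑ k ∈ Finset.Ici (σ.symm v), w k + t⌋ : ℝ)) =
        G.partialSum σ i + G.combo fun v => (f₀ v : ℝ) := by
    intro t i ht0 ht1 h
    rw [partialSum_eq_combo, ← map_add]
    congr 1
    ext v
    rw [floor_add_add_eq (hs0 _) (hs1 _) ht0 ht1]
    simp only [h, Pi.add_apply]
    push_cast
    ring
  ext y
  constructor
  · rintro ⟨f, hf, rfl⟩
    obtain ⟨c, hc⟩ := hG.exists_eq_add_of_combo_eq hf
    obtain ⟨i, hi, hi'⟩ := exists_forall_le_sum_Ici_iff hw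
      (sub_pos.2 (Int.fract_lt_one c)) (by rw [hw1]; linarith [Int.fract_nonneg c])
    refine ⟨i, hi, ?_⟩
    rw [← key _ i (Int.fract_nonneg c) (Int.fract_lt_one c) hi']
    refine Eq.trans ?_ (G.combo_add_const _ (⌊c⌋ : ℝ))
    congr 1
    ext v
    rw [hc v]
    have hv : (f₀ v : ℝ) + ∑ k ∈ Finset.Ici (σ.symm v), w k + c =
        (f₀ v : ℝ) + ∑ k ∈ Finset.Ici (σ.symm v), w k + Int.fract c + (⌊c⌋ : ℤ) := by
      rw [add_assoc _ (Int.fract c), Int.fract_add_floor]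
    rw [hv, Int.floor_add_intCast]
    push_cast
    rfl
  · rintro ⟨i, hi, rfl⟩
    have hpos : 0 < ∑ k ∈ Finset.Ici i, w k := by
      rw [sum_Ici_eq_add_sum_Ioi]
      have := Finset.sum_nonneg fun j (_ : j ∈ Finset.Ioi i) => hw j
      linarith
    refine ⟨_, G.combo_add_const _ (1 - ∑ k ∈ Finset.Ici i, w k), ?_⟩
    -- The threshold `1 - t` is chosen to be the tail sum at `i`; since `w i > 0`, later tails fall
    -- strictly below it.
    refine (key _ i (by linarith [hs1 i]) (by linarith) fun j => ?_).symm
    rw [sub_sub_cancel]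
    refine ⟨fun h => ?_, sum_Ici_anti hw⟩
    by_contra hlt
    exact absurd (sum_Ici_lt hw (not_le.1 hlt) hi) (not_lt.2 h)

theorem Connected.affineIndependent_partialSum (hG : G.Connected) (σ : Equiv.Perm (Fin (n + 1)))
    (p : H0 n) : AffineIndependent ℝ fun i => G.partialSum σ i + p := by
  rw [affineIndependent_iff]
  intro s w hw hws e he
  let w' : Fin (n + 1) → ℝ := fun i => if i ∈ s then w i else 0
  have h1 : ∑ i, w' i = 0 := by simpa [w', Finset.sum_ite_mem] using hw
  have h2 : ∑ i, w' i • (G.partialSum σ i + p) = 0 := by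
    simp only [w', ite_smul, zero_smul, Finset.sum_ite_mem, Finset.univ_inter]
    exact hws
  simp only [smul_add, Finset.sum_add_distrib] at h2
  rw [← Finset.sum_smul, h1, zero_smul, add_zero, sum_smul_partialSum] at h2
  have h3 := eq_zero_of_sum_Ici_eq_zero (w := w') (fun j => by
    have := hG.eq_of_combo_eq_zero h2 (σ j) (σ 0)
    simpa only [Equiv.symm_apply_apply, sum_Ici_zero, h1] using this) e
  simpa [w', he] using h3

theorem Connected.partialSum_add_injective (hG : G.Connected) (σ : Equiv.Perm (Fin (n + 1)))
    (p : H0 n) : Function.Injective fun i => G.partialSum σ i + p :=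
  (hG.affineIndependent_partialSum σ p).injective

theorem Connected.carrier_subset_and_mem (hG : G.Connected) {s : Finset (H0 n)}
    (hs : s ∈ G.delFaces) {x : H0 n} (hx : x ∈ convexHull ℝ (s : Set (H0 n))) :
    G.carrier x ⊆ s ∧ x ∈ convexHull ℝ (G.carrier x) := by
  classical
  obtain ⟨-, σ, p, hp, hsub⟩ := hs
  obtain ⟨ω, hω0, hω1, rfl⟩ := Finset.mem_convexHull'.1 hx
  have hinj := hG.partialSum_add_injective σ p
  -- Weights on a face are extended by zero to the full simplex of `σ`.
  let w : Fin (n + 1) → ℝ := fun i =>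
    if G.partialSum σ i + p ∈ s then ω (G.partialSum σ i + p) else 0
  have hw0 : ∀ i, 0 ≤ w i := fun i => by
    simp only [w]
    split_ifs with h
    exacts [hω0 _ h, le_rfl]
  have hw1 : ∑ i, w i = 1 := (sum_ite_mem_eq_sum hinj hsub ω).trans hω1
  have hx' : ∑ y ∈ s, ω y • y = ∑ i, w i • (G.partialSum σ i + p) := by
    rw [← sum_ite_mem_eq_sum hinj hsub fun y => ω y • y]
    simp only [w, ite_smul, zero_smul]
  rw [hx', hG.carrier_eq σ hp hw0 hw1]
  constructor
  · rintro y ⟨i, hi, rfl⟩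
    by_contra h
    simp only [w] at hi
    rw [if_neg (by exact h)] at hi
    exact lt_irrefl _ hi
  · have hpos : ∑ i ∈ Finset.univ.filter (fun i => 0 < w i), w i = 1 := by
      rw [← hw1]
      refine Finset.sum_filter_of_ne fun i _ h => lt_of_le_of_ne (hw0 i) h.symm
    have hx2 : ∑ i, w i • (G.partialSum σ i + p) =
        ∑ i ∈ Finset.univ.filter (fun i => 0 < w i), w i • (G.partialSum σ i + p) :=
      (Finset.sum_filter_of_ne fun i _ h => lt_of_le_of_ne (hw0 i) fun h0 => h (by
        rw [← h0, zero_smul])).symm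
    rw [hx2]
    exact (convex_convexHull ℝ _).sum_mem (fun i _ => hw0 i) hpos fun i hi =>
      subset_convexHull ℝ _ ⟨i, (Finset.mem_filter.1 hi).2, rfl⟩

/-- The triangulation `Del(G)`. -/
def Connected.delComplex (hG : G.Connected) : Geometry.SimplicialComplex ℝ (H0 n) where
  faces := G.delFaces
  isRelLowerSet_faces := by
    rintro s ⟨hs, σ, p, hp, hsub⟩
    exact ⟨hs, fun t hts ht => ⟨ht, σ, p, hp, (Finset.coe_subset.2 hts).trans hsub⟩⟩
  indep := by
    rintro s ⟨-, σ, p, -, hsub⟩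
    exact (hG.affineIndependent_partialSum σ p).range.mono hsub
  inter_subset_convexHull := by
    rintro s t hs ht x ⟨hxs, hxt⟩
    -- `carrier x` lies in both `s` and `t`, and its hull contains `x`.
    obtain ⟨h1, h2⟩ := hG.carrier_subset_and_mem hs hxs
    exact convexHull_mono (Set.subset_inter h1 (hG.carrier_subset_and_mem ht hxt).1) h2

variable (G)

theorem exists_combo_mem_convexHull {f : Fin (n + 1) → ℝ} (hf : f ∈ Set.Icc 0 1) :
    ∃ σ, G.combo f ∈ convexHull ℝ (Set.range (G.partialSum σ)) := by
  -- `σ` lists the values of `f` in decreasing order. Adding `c` raises the largest to 1 without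
  -- changing `combo f`, and the successive differences are then weights with sum 1.
  let σ : Equiv.Perm (Fin (n + 1)) := Fin.revPerm.trans (Tuple.sort f)
  have hσ : ∀ i j, i ≤ j → f (σ j) ≤ f (σ i) := fun i j hij =>
    Tuple.monotone_sort f (Fin.rev_le_rev.2 hij)
  let c := 1 - f (σ 0)
  have hc : 0 ≤ c := sub_nonneg.2 (hf.2 _)
  -- The value 0 past the end makes the last weight `f (σ n) + c`, so that the tail sums recover `f
  -- + c`.
  let g : ℕ → ℝ := fun k => if h : k < n + 1 then f (σ ⟨k, h⟩) + c else 0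
  have hg : ∀ i : Fin (n + 1), g i = f (σ i) + c := fun i => dif_pos i.2
  have hglast : g (n + 1) = 0 := by simp [g]
  have hsum : ∀ j, ∑ i ∈ Finset.Ici j, (g (i : Fin (n + 1)) - g (i + 1)) = f (σ j) + c :=
    fun j => by rw [sum_Ici_telescope, hglast, sub_zero, hg]
  refine ⟨σ, mem_convexHull_of_exists_fintype (fun i : Fin (n + 1) => g i - g (i + 1))
    (G.partialSum σ) (fun i => ?_) ?_ (fun i => ⟨i, rfl⟩) ?_⟩
  · rw [hg, sub_nonneg]
    simp only [g]
    split_ifs with h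
    · exact add_le_add (hσ _ _ (by rw [Fin.le_def]; simp)) le_rfl
    · exact add_nonneg (hf.1 _) hc
  · rw [← sum_Ici_zero, hsum]
    simp [c]
  · rw [sum_smul_partialSum, ← G.combo_add_const f c]
    simp only [hsum, Equiv.apply_symm_apply]

theorem exists_mem_convexHull_partialSum_add {G : Multigraph n} (hG : G.Connected) (x : H0 n) :
    ∃ σ, ∃ p ∈ G.lattice, x ∈ convexHull ℝ (Set.range fun i => G.partialSum σ i + p) := by
  obtain ⟨f, rfl⟩ := hG.combo_surjective x
  obtain ⟨σ, hσ⟩ := G.exists_combo_mem_convexHull (f := fun v => Int.fract (f v))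
    ⟨fun v => Int.fract_nonneg _, fun v => (Int.fract_lt_one _).le⟩
  refine ⟨σ, _, G.mem_lattice_iff.2 ⟨fun v => ⌊f v⌋, rfl⟩, ?_⟩
  set p := G.combo fun v => (⌊f v⌋ : ℝ) with hp
  have h1 : (Set.range fun i => G.partialSum σ i + p) = p +ᵥ Set.range (G.partialSum σ) := by
    ext y
    simp only [Set.mem_vadd_set, Set.mem_range, exists_exists_eq_and, vadd_eq_add, add_comm p]
  have h2 : G.combo f = p + G.combo fun v => Int.fract (f v) := by
    rw [hp, ← map_add]
    congr 1
    ext v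
    simp
  rw [h1, convexHull_vadd, h2]
  exact Set.vadd_mem_vadd_set hσ

theorem range_partialSum_add_mem_delFaces [DecidableEq (H0 n)] (σ : Equiv.Perm (Fin (n + 1)))
    {p : H0 n} (hp : p ∈ G.lattice) :
    Finset.univ.image (fun i => G.partialSum σ i + p) ∈ G.delFaces :=
  ⟨Finset.univ_nonempty.image _, σ, p, hp, by simp⟩

theorem subset_lattice_of_mem_delFaces {s : Finset (H0 n)} (hs : s ∈ G.delFaces) :
    (s : Set (H0 n)) ⊆ G.lattice := by
  obtain ⟨-, σ, p, hp, hsub⟩ := hs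
  intro y hy
  obtain ⟨i, rfl⟩ := hsub hy
  exact add_mem (G.partialSum_mem_lattice σ i) hp

theorem finite_lattice_inter_closedBall (x : H0 n) (r : ℝ) :
    ((G.lattice : Set (H0 n)) ∩ Metric.closedBall x r).Finite := by
  -- Lattice points have integer coordinates, so taking floors is injective on them.
  let ψ : H0 n → Fin (n + 1) → ℤ := fun q v => ⌊(q : Fin (n + 1) → ℝ) v⌋
  refine Set.Finite.of_finite_image (f := ψ) ?_ ?_
  · refine Set.Finite.subset (Set.finite_Icc (fun v => ⌊(x : Fin (n + 1) → ℝ) v - r⌋)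
      (fun v => ⌊(x : Fin (n + 1) → ℝ) v + r⌋)) ?_
    rintro _ ⟨q, ⟨-, hq⟩, rfl⟩
    have hq' : ∀ v, |(q : Fin (n + 1) → ℝ) v - (x : Fin (n + 1) → ℝ) v| ≤ r := fun v =>
      (norm_le_pi_norm (q - x : Fin (n + 1) → ℝ) v).trans (mem_closedBall_iff_norm.1 hq)
    exact ⟨fun v => Int.floor_mono (by linarith [(abs_le.1 (hq' v)).1]),
      fun v => Int.floor_mono (by linarith [(abs_le.1 (hq' v)).2])⟩
  · rintro q ⟨hq, -⟩ q' ⟨hq', -⟩ h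
    obtain ⟨z, hz⟩ := G.exists_int_eq_of_mem_lattice hq
    obtain ⟨z', hz'⟩ := G.exists_int_eq_of_mem_lattice hq'
    refine H0.ext_coe fun v => ?_
    have hv : ψ q v = ψ q' v := congrFun h v
    simp only [ψ, hz, hz', Int.floor_intCast] at hv
    rw [hz, hz', hv]

theorem exists_forall_dist_le_of_mem_delFaces :
    ∃ D : ℝ, ∀ s ∈ G.delFaces, ∀ y ∈ s, ∀ z ∈ s, dist y z ≤ D := by
  obtain ⟨D, hD⟩ := (Set.finite_range fun a : Equiv.Perm (Fin (n + 1)) × Fin (n + 1) × Fin (n + 1) =>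
    dist (G.partialSum a.1 a.2.1) (G.partialSum a.1 a.2.2)).bddAbove
  refine ⟨D, ?_⟩
  rintro s ⟨-, σ, p, -, hsub⟩ y hy z hz
  obtain ⟨i, rfl⟩ := hsub hy
  obtain ⟨j, rfl⟩ := hsub hz
  simp only [dist_add_right]
  exact hD ⟨(σ, i, j), rfl⟩

variable {G}

theorem Connected.isTriangulation (hG : G.Connected) :
    IsTriangulation (G.lattice : Set (H0 n)) hG.delComplex := by
  classical
  have hspace : hG.delComplex.space = Set.univ := by
    refine Set.eq_univ_of_forall fun x => ?_
    obtain ⟨σ, p, hp, hx⟩ := exists_mem_convexHull_partialSum_add hG x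
    rw [Geometry.SimplicialComplex.mem_space_iff]
    exact ⟨_, G.range_partialSum_add_mem_delFaces σ hp, by simpa using hx⟩
  refine ⟨?_, ?_, ?_⟩
  · ext x
    rw [Geometry.SimplicialComplex.mem_vertices]
    constructor
    · intro hx
      exact G.subset_lattice_of_mem_delFaces hx (by simp)
    · intro hx
      refine ⟨Finset.singleton_nonempty x, 1, x, hx, ?_⟩
      simp only [Finset.coe_singleton, Set.singleton_subset_iff]
      exact ⟨Fin.last n, by simp [partialSum_last]⟩
  · refine Set.Subset.antisymm ?_ (by rw [hspace]; exact Set.subset_univ _)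
    exact Set.iUnion₂_subset fun s hs => convexHull_mono (G.subset_lattice_of_mem_delFaces hs)
  · obtain ⟨D, hD⟩ := G.exists_forall_dist_le_of_mem_delFaces
    intro x
    refine ⟨Metric.closedBall x 1, Metric.closedBall_mem_nhds x one_pos, ?_⟩
    -- Simplices have diameter at most `D`, so those meeting the unit ball have all their vertices
    -- in a finite set of lattice points.
    have hfin := G.finite_lattice_inter_closedBall x (D + 1)
    refine Set.Finite.of_finite_image (f := fun s : hG.delComplex.faces => (s : Finset (H0 n)))
      (hfin.toFinset.powerset.finite_toSet.subset ?_) Subtype.val_injective.injOn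
    rintro _ ⟨⟨s, hs⟩, ⟨z, hz, hzx⟩, rfl⟩
    simp only [Finset.coe_powerset, Set.mem_preimage, Set.mem_powerset_iff, Set.Finite.coe_toFinset]
    intro y hy
    refine ⟨G.subset_lattice_of_mem_delFaces hs hy, ?_⟩
    obtain ⟨z', hz', hyz⟩ := convexHull_exists_dist_ge hz y
    have h1 := hD s hs z' hz' y hy
    rw [Metric.mem_closedBall] at hzx ⊢
    linarith [dist_triangle_left y x z]

/-! ### The star of the origin determines the multigraph -/

variable (G)

theorem originStar_delFaces : originStar G.delFaces = G.combo '' Set.Icc 0 1 := by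
  classical
  apply Set.Subset.antisymm
  · refine Set.iUnion₂_subset ?_
    rintro s ⟨⟨-, σ, p, -, hsub⟩, h0⟩
    refine convexHull_min ?_ ((convex_Icc 0 1).linear_image G.combo)
    intro y hy
    obtain ⟨i, hi⟩ := hsub h0
    obtain ⟨j, rfl⟩ := hsub hy
    simp only at hi ⊢
    -- The origin is the vertex with index `i`, so `p = -u^σ_i` and the others are differences of
    -- partial sums. These are combinations with 0/1 coefficients, after adding 1 when `j ≤ i`.
    rw [eq_neg_of_add_eq_zero_right hi, ← sub_eq_add_neg, partialSum_eq_combo,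
      partialSum_eq_combo, ← map_sub]
    rcases le_total i j with hij | hij
    · refine ⟨_, ?_, rfl⟩
      constructor <;> intro v <;>
        simp only [Pi.sub_apply, Pi.zero_apply, Pi.one_apply] <;> split_ifs <;>
        first | (norm_num; done) | exact absurd (le_trans (by assumption) hij) (by assumption)
    · refine ⟨_, ?_, G.combo_add_const _ 1⟩
      constructor <;> intro v <;>
        simp only [Pi.sub_apply, Pi.zero_apply, Pi.one_apply] <;> split_ifs <;>
        first | (norm_num; done) | exact absurd (le_trans (by assumption) hij) (by assumption)
  · rintro _ ⟨f, hf, rfl⟩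
    obtain ⟨σ, hσ⟩ := G.exists_combo_mem_convexHull hf
    refine Set.mem_iUnion₂.2 ⟨_, ⟨G.range_partialSum_add_mem_delFaces σ (zero_mem _), ?_⟩, ?_⟩
    · exact Finset.mem_image.2 ⟨Fin.last n, Finset.mem_univ _, by simp [partialSum_last]⟩
    · simpa using hσ

/-- The numbers `mult u v * (1 - f v + f u)` are nonnegative on the cube, and together with
coordinate `v` they add up to the degree of `v`. Using this for `(v, w)` and `(w, v)` cancels `f`
and leaves twice the multiplicity. -/
theorem combo_apply_add_le {f : Fin (n + 1) → ℝ} (hf : f ∈ Set.Icc 0 1) (v w : Fin (n + 1)) :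
    (G.combo f : Fin (n + 1) → ℝ) v + G.mult w v * (1 - f v + f w) ≤ ∑ u, (G.mult u v : ℝ) := by
  have h := Finset.single_le_sum (f := fun u => (G.mult u v : ℝ) * (1 - f v + f u))
    (fun u _ => mul_nonneg (Nat.cast_nonneg _) (by
      have h1 : f v ≤ 1 := hf.2 v
      have h2 : 0 ≤ f u := hf.1 u
      linarith)) (Finset.mem_univ w)
  have h2 : (G.combo f : Fin (n + 1) → ℝ) v + ∑ u, (G.mult u v : ℝ) * (1 - f v + f u) =
      ∑ u, (G.mult u v : ℝ) := by
    rw [combo_apply, ← Finset.sum_add_distrib]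
    exact Finset.sum_congr rfl fun _ _ => by ring
  linarith

theorem combo_apply_le {f : Fin (n + 1) → ℝ} (hf : f ∈ Set.Icc 0 1) (v : Fin (n + 1)) :
    (G.combo f : Fin (n + 1) → ℝ) v ≤ ∑ u, (G.mult u v : ℝ) := by
  simpa [G.loopless] using G.combo_apply_add_le hf v v

theorem combo_apply_add_combo_apply_le {f : Fin (n + 1) → ℝ} (hf : f ∈ Set.Icc 0 1)
    (v w : Fin (n + 1)) : (G.combo f : Fin (n + 1) → ℝ) v + (G.combo f : Fin (n + 1) → ℝ) w ≤
      ∑ u, (G.mult u v : ℝ) + ∑ u, (G.mult u w : ℝ) - 2 * G.mult v w := by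
  have h1 := G.combo_apply_add_le hf v w
  have h2 := G.combo_apply_add_le hf w v
  rw [G.symm w v] at h1
  linarith

theorem combo_single_apply (v : Fin (n + 1)) :
    (G.combo (Pi.single v 1) : Fin (n + 1) → ℝ) v = ∑ u, (G.mult u v : ℝ) := by
  rw [combo_apply]
  refine Finset.sum_congr rfl fun u _ => ?_
  rcases eq_or_ne u v with rfl | h
  · simp [G.loopless]
  · simp [h]

theorem combo_pair_apply {v w : Fin (n + 1)} (h : v ≠ w) :
    (G.combo (Pi.single v 1 + Pi.single w 1) : Fin (n + 1) → ℝ) v =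
      ∑ u, (G.mult u v : ℝ) - G.mult w v := by
  have h1 : ∀ u, (G.mult u v : ℝ) * ((Pi.single v 1 + Pi.single w 1 : Fin (n + 1) → ℝ) v -
      (Pi.single v 1 + Pi.single w 1 : Fin (n + 1) → ℝ) u) =
      G.mult u v - if u = w then (G.mult u v : ℝ) else 0 := by
    intro u
    rcases eq_or_ne u v with rfl | huv
    · simp [G.loopless]
    · rcases eq_or_ne u w with rfl | huw <;> simp [*]
  rw [combo_apply, Finset.sum_congr rfl fun u _ => h1 u, Finset.sum_sub_distrib,
    Finset.sum_ite_eq', if_pos (Finset.mem_univ w)]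

theorem deg_le_of_originStar_subset {G₁ G₂ : Multigraph n}
    (h : originStar G₁.delFaces ⊆ originStar G₂.delFaces) (v : Fin (n + 1)) :
    ∑ u, (G₁.mult u v : ℝ) ≤ ∑ u, (G₂.mult u v : ℝ) := by
  rw [originStar_delFaces, originStar_delFaces] at h
  obtain ⟨f, hf, hf'⟩ := h ⟨Pi.single v 1, ⟨by simp, fun u => by
    rcases eq_or_ne u v with rfl | h <;> simp [*]⟩, rfl⟩
  rw [← combo_single_apply G₁, ← hf']
  exact G₂.combo_apply_le hf v

theorem deg_add_deg_le_of_originStar_subset {G₁ G₂ : Multigraph n}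
    (h : originStar G₁.delFaces ⊆ originStar G₂.delFaces) {v w : Fin (n + 1)} (hvw : v ≠ w) :
    ∑ u, (G₁.mult u v : ℝ) + ∑ u, (G₁.mult u w : ℝ) - 2 * G₁.mult v w ≤
      ∑ u, (G₂.mult u v : ℝ) + ∑ u, (G₂.mult u w : ℝ) - 2 * G₂.mult v w := by
  rw [originStar_delFaces, originStar_delFaces] at h
  obtain ⟨f, hf, hf'⟩ := h ⟨Pi.single v 1 + Pi.single w 1, ⟨fun u => by
    rcases eq_or_ne u v with rfl | h1 <;> rcases eq_or_ne u w with rfl | h2 <;> simp [*],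
    fun u => by
    rcases eq_or_ne u v with rfl | h1 <;> rcases eq_or_ne u w with rfl | h2 <;> simp_all⟩, rfl⟩
  have h1 := G₂.combo_apply_add_combo_apply_le hf v w
  rw [hf', combo_pair_apply G₁ hvw, add_comm (Pi.single v 1), combo_pair_apply G₁ hvw.symm,
    G₁.symm w v] at h1
  linarith

theorem eq_of_originStar_eq {G₁ G₂ : Multigraph n}
    (h : originStar G₁.delFaces = originStar G₂.delFaces) : G₁ = G₂ := by
  ext v w
  rcases eq_or_ne v w with rfl | hvw
  · rw [G₁.loopless, G₂.loopless]
  have hd : ∀ v, ∑ u, (G₁.mult u v : ℝ) = ∑ u, (G₂.mult u v : ℝ) := fun v =>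
    le_antisymm (deg_le_of_originStar_subset h.le v) (deg_le_of_originStar_subset h.ge v)
  have h1 := deg_add_deg_le_of_originStar_subset h.le hvw
  have h2 := deg_add_deg_le_of_originStar_subset h.ge hvw
  rw [hd, hd] at h1
  rw [hd, hd] at h2
  exact_mod_cast (by linarith : (G₁.mult v w : ℝ) = G₂.mult v w)

theorem eq_of_laplacian_eq {G₁ G₂ : Multigraph n} (h : G₁.laplacian = G₂.laplacian) :
    G₁ = G₂ := by
  ext v w
  rcases eq_or_ne v w with rfl | hvw
  · rw [G₁.loopless, G₂.loopless]
  simpa [laplacian, hvw] using congrFun (congrFun h v) w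

end Multigraph


open Filter Topology

/-! ### The simplicial distance in coordinates -/

section SimplicialDistance

variable {n : ℕ}

theorem mem_regularSimplex_iff {y : H0 n} :
    y ∈ regularSimplex n ↔ ∀ i, -1 ≤ (y : Fin (n + 1) → ℝ) i := by
  constructor
  · have hconv : Convex ℝ {y : H0 n | ∀ i, -1 ≤ (y : Fin (n + 1) → ℝ) i} := by
      intro y hy z hz a b ha hb hab i
      have h1 := mul_le_mul_of_nonneg_left (hy i) ha
      have h2 := mul_le_mul_of_nonneg_left (hz i) hb
      simp only [Submodule.coe_add, Submodule.coe_smul, Pi.add_apply, Pi.smul_apply, smul_eq_mul]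
      linarith
    intro hy
    refine convexHull_min ?_ hconv hy
    rintro _ ⟨i, rfl⟩ j
    change -1 ≤ if j = i then (n : ℝ) else -1
    split_ifs
    · linarith [Nat.cast_nonneg (α := ℝ) n]
    · exact le_rfl
  · intro hy
    have hn : (n : ℝ) + 1 ≠ 0 := by positivity
    have hsum : ∑ i, ((y : Fin (n + 1) → ℝ) i + 1) / (n + 1) = 1 := by
      rw [← Finset.sum_div, Finset.sum_add_distrib, H0.sum_coe_eq_zero y]
      simp [hn]
    -- The barycentric coordinates of `y` are `(y_i + 1)/(n + 1)`.
    refine mem_convexHull_of_exists_fintype (fun i => ((y : Fin (n + 1) → ℝ) i + 1) / (n + 1))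
      (simplexVertex n) (fun i => div_nonneg (by linarith [hy i]) (by positivity)) hsum
      (fun i => ⟨i, rfl⟩) ?_
    refine H0.ext_coe fun j => ?_
    rw [AddSubmonoidClass.coe_finsetSum, Finset.sum_apply]
    simp only [Submodule.coe_smul, Pi.smul_apply, smul_eq_mul, simplexVertex]
    have h : ∀ i, ((y : Fin (n + 1) → ℝ) i + 1) / (n + 1) * (if j = i then (n : ℝ) else -1) =
        (if j = i then (y : Fin (n + 1) → ℝ) i + 1 else 0) -
          ((y : Fin (n + 1) → ℝ) i + 1) / (n + 1) := by
      intro i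
      split_ifs
      · field_simp
        ring
      · ring
    rw [Finset.sum_congr rfl fun i _ => h i, Finset.sum_sub_distrib, hsum, Finset.sum_ite_eq,
      if_pos (Finset.mem_univ j), add_sub_cancel_right]

theorem H0.eq_of_forall_le {x y : H0 n}
    (h : ∀ i, (x : Fin (n + 1) → ℝ) i ≤ (y : Fin (n + 1) → ℝ) i) : x = y :=
  H0.ext_coe fun i => (Finset.sum_eq_sum_iff_of_le fun i _ => h i).1
    (by rw [H0.sum_coe_eq_zero x, H0.sum_coe_eq_zero y]) i (Finset.mem_univ i)

theorem mem_dilate_iff {c q : H0 n} {r : ℝ} (hr : 0 ≤ r) :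
    q ∈ dilate (regularSimplex n) c r ↔
      ∀ i, (c : Fin (n + 1) → ℝ) i - r ≤ (q : Fin (n + 1) → ℝ) i := by
  simp only [dilate, Set.mem_vadd_set, Set.mem_smul_set, exists_exists_and_eq_and, vadd_eq_add]
  constructor
  · rintro ⟨y, hy, rfl⟩ i
    have := mul_le_mul_of_nonneg_left (mem_regularSimplex_iff.1 hy i) hr
    simp only [Submodule.coe_add, Submodule.coe_smul, Pi.add_apply, Pi.smul_apply, smul_eq_mul]
    linarith
  · intro h
    rcases hr.eq_or_lt with rfl | hr
    · refine ⟨0, mem_regularSimplex_iff.2 fun i => by simp, ?_⟩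
      rw [zero_smul, add_zero]
      exact H0.eq_of_forall_le fun i => by linarith [h i]
    · refine ⟨r⁻¹ • (q - c), mem_regularSimplex_iff.2 fun i => ?_, by
        rw [smul_inv_smul₀ hr.ne', add_sub_cancel]⟩
      simp only [Submodule.coe_sub, Submodule.coe_smul, Pi.sub_apply, Pi.smul_apply, smul_eq_mul]
      rw [inv_mul_eq_div, le_div_iff₀ hr]
      linarith [h i]

theorem nonneg_of_forall_sub_le {c q : H0 n} {r : ℝ}
    (h : ∀ i, (c : Fin (n + 1) → ℝ) i - r ≤ (q : Fin (n + 1) → ℝ) i) : 0 ≤ r := by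
  have h1 := Finset.sum_le_sum fun i (_ : i ∈ Finset.univ) => h i
  rw [Finset.sum_sub_distrib, H0.sum_coe_eq_zero c, H0.sum_coe_eq_zero q] at h1
  simp only [Finset.sum_const, Finset.card_univ, Fintype.card_fin, nsmul_eq_mul] at h1
  push_cast at h1
  nlinarith [Nat.cast_nonneg (α := ℝ) n]

theorem polyDist_le {c q : H0 n} {r : ℝ}
    (h : ∀ i, (c : Fin (n + 1) → ℝ) i - r ≤ (q : Fin (n + 1) → ℝ) i) :
    polyDist (regularSimplex n) c q ≤ r :=
  csInf_le ⟨0, fun _ h => h.1⟩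
    ⟨nonneg_of_forall_sub_le h, (mem_dilate_iff (nonneg_of_forall_sub_le h)).2 h⟩

theorem le_polyDist {c q : H0 n} {r : ℝ} {i : Fin (n + 1)}
    (h : (q : Fin (n + 1) → ℝ) i ≤ (c : Fin (n + 1) → ℝ) i - r) :
    r ≤ polyDist (regularSimplex n) c q := by
  -- Nonemptiness matters: the infimum of the empty set would be 0.
  refine le_csInf ?_ fun s hs => ?_
  · obtain ⟨M, hM⟩ := (Set.finite_range fun i =>
      (c : Fin (n + 1) → ℝ) i - (q : Fin (n + 1) → ℝ) i).bddAbove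
    have h' : ∀ i, (c : Fin (n + 1) → ℝ) i - M ≤ (q : Fin (n + 1) → ℝ) i := fun i => by
      linarith [hM ⟨i, rfl⟩]
    exact ⟨M, nonneg_of_forall_sub_le h', (mem_dilate_iff (nonneg_of_forall_sub_le h')).2 h'⟩
  · linarith [(mem_dilate_iff hs.1).1 hs.2 i]

theorem exists_apply_le_sub_distToSet {S : Set (H0 n)} (c : H0 n) {q : H0 n} (hq : q ∈ S) :
    ∃ i, (q : Fin (n + 1) → ℝ) i ≤
      (c : Fin (n + 1) → ℝ) i - distToSet (regularSimplex n) S c := by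
  obtain ⟨i, hi⟩ := Finite.exists_max fun i =>
    (c : Fin (n + 1) → ℝ) i - (q : Fin (n + 1) → ℝ) i
  have h1 : polyDist (regularSimplex n) c q ≤ (c : Fin (n + 1) → ℝ) i - (q : Fin (n + 1) → ℝ) i :=
    polyDist_le fun j => by linarith [hi j]
  have h2 : distToSet (regularSimplex n) S c ≤ polyDist (regularSimplex n) c q :=
    ciInf_le (f := fun q : S => polyDist (regularSimplex n) c q)
      ⟨0, by rintro _ ⟨_, rfl⟩; exact Real.sInf_nonneg fun _ h => h.1⟩ ⟨q, hq⟩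
  exact ⟨i, by linarith⟩

theorem le_distToSet {S : Set (H0 n)} (hS : S.Nonempty) {c : H0 n} {r : ℝ}
    (h : ∀ q ∈ S, ∃ i, (q : Fin (n + 1) → ℝ) i ≤ (c : Fin (n + 1) → ℝ) i - r) :
    r ≤ distToSet (regularSimplex n) S c := by
  have := hS.to_subtype
  refine le_ciInf fun q => ?_
  obtain ⟨i, hi⟩ := h q q.2
  exact le_polyDist hi

theorem mem_frontier_dilate (hn : 1 ≤ n) {c q : H0 n} {r : ℝ}
    (h : ∀ i, (c : Fin (n + 1) → ℝ) i - r ≤ (q : Fin (n + 1) → ℝ) i) {k : Fin (n + 1)}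
    (hk : (q : Fin (n + 1) → ℝ) k = (c : Fin (n + 1) → ℝ) k - r) :
    q ∈ frontier (dilate (regularSimplex n) c r) := by
  have hr := nonneg_of_forall_sub_le h
  refine ⟨subset_closure ((mem_dilate_iff hr).2 h), fun hint => ?_⟩
  -- Moving against `t_k` lowers coordinate `k` at rate `n > 0`, hence leaves the simplex at once.
  have hcont : Tendsto (fun t : ℝ => q - t • simplexVertex n k) (𝓝[>] 0) (𝓝 q) := by
    have : Continuous fun t : ℝ => q - t • simplexVertex n k := by fun_prop
    simpa using (this.tendsto 0).mono_left nhdsWithin_le_nhds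
  obtain ⟨t, ht, ht0⟩ :=
    ((hcont.eventually (mem_interior_iff_mem_nhds.1 hint)).and self_mem_nhdsWithin).exists
  have h1 := (mem_dilate_iff hr).1 ht k
  have h2 : ((q - t • simplexVertex n k : H0 n) : Fin (n + 1) → ℝ) k =
      (q : Fin (n + 1) → ℝ) k - t * n := by
    simp [simplexVertex]
  have h3 : 0 < t * n := mul_pos ht0 (by exact_mod_cast hn)
  linarith

end SimplicialDistance

/-! ### Burning orders and local maxima of the distance function -/

theorem exists_perm_forall_image_Iio {n : ℕ} {P : Finset (Fin (n + 1)) → Fin (n + 1) → Prop}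
    (h : ∀ B, B ≠ Finset.univ → ∃ v, v ∉ B ∧ P B v) :
    ∃ σ : Equiv.Perm (Fin (n + 1)), ∀ m, P ((Finset.Iio m).image σ) (σ m) := by
  choose! pick hpick hP using h
  -- Greedy construction: `B k` holds the first `k` picks, which are distinct.
  let B : ℕ → Finset (Fin (n + 1)) := fun k => Nat.rec ∅ (fun _ B => insert (pick B) B) k
  have hsucc : ∀ k, B (k + 1) = insert (pick (B k)) (B k) := fun _ => rfl
  have hne : ∀ k, k < n + 1 → (B k).card = k → B k ≠ Finset.univ := by
    intro k hk hc hu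
    rw [hu, Finset.card_univ, Fintype.card_fin] at hc
    omega
  have hcard : ∀ k, k ≤ n + 1 → (B k).card = k := by
    intro k
    induction k with
    | zero => intro _; rfl
    | succ k ih =>
      intro hk
      have hk' := ih (by omega)
      rw [hsucc, Finset.card_insert_of_notMem (hpick _ (hne k (by omega) hk')), hk']
  have hB : ∀ k, B k = (Finset.range k).image fun j => pick (B j) := by
    intro k
    induction k with
    | zero => rfl
    | succ k ih => rw [hsucc, Finset.range_add_one, Finset.image_insert, ← ih]
  have hnot : ∀ i : Fin (n + 1), B i ≠ Finset.univ := fun i => hne i i.2 (hcard i i.2.le)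
  have hlt : ∀ i j : Fin (n + 1), i < j → pick (B i) ≠ pick (B j) := by
    intro i j hij heq
    refine hpick _ (hnot j) ?_
    rw [← heq, hB j]
    exact Finset.mem_image.2 ⟨i, Finset.mem_range.2 hij, rfl⟩
  have hinj : Function.Injective fun i : Fin (n + 1) => pick (B i) := by
    intro i j hij
    rcases lt_trichotomy i j with h1 | h1 | h1
    · exact absurd hij (hlt i j h1)
    · exact h1
    · exact absurd hij.symm (hlt j i h1)
  refine ⟨Equiv.ofBijective _ (Finite.injective_iff_bijective.1 hinj), fun m => ?_⟩
  have himg : (Finset.Iio m).image (Equiv.ofBijective _ (Finite.injective_iff_bijective.1 hinj)) =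
      B m := by
    rw [hB m]
    ext v
    simp only [Finset.mem_image, Finset.mem_Iio, Equiv.ofBijective_apply, Finset.mem_range]
    constructor
    · rintro ⟨i, hi, rfl⟩
      exact ⟨i, hi, rfl⟩
    · rintro ⟨i, hi, rfl⟩
      exact ⟨⟨i, hi.trans m.2⟩, hi, rfl⟩
  rw [himg]
  exact hP _ (hnot m)

namespace Multigraph

variable {n : ℕ} {G : Multigraph n}

theorem Connected.exists_combo_eq_off (hG : G.Connected) (z : Fin (n + 1) → ℝ) (a : Fin (n + 1)) :
    ∃ g : Fin (n + 1) → ℝ, g a = 0 ∧ ∀ v, v ≠ a → (G.combo g : Fin (n + 1) → ℝ) v = z v := by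
  let d : H0 n := ⟨fun v => z v - if v = a then ∑ u, z u else 0, by
    change ∑ v, (z v - if v = a then ∑ u, z u else 0) = 0
    simp⟩
  obtain ⟨g, hg⟩ := hG.combo_surjective d
  refine ⟨fun v => g v + -g a, by ring, fun v hv => ?_⟩
  rw [combo_add_const, hg]
  simp [d, hv]

theorem Connected.exists_int_lt_combo_off (hG : G.Connected) (x : Fin (n + 1) → ℝ)
    (a : Fin (n + 1)) : ∃ f : Fin (n + 1) → ℤ, f a = 0 ∧
      ∀ v, v ≠ a → x v < (G.combo fun u => (f u : ℝ) : Fin (n + 1) → ℝ) v := by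
  -- Rounding `g` down lowers coordinate `v` by at most its degree; the margin `1 + deg v` absorbs
  -- this.
  obtain ⟨g, hga, hg⟩ := hG.exists_combo_eq_off (fun v => x v + 1 + ∑ u, (G.mult u v : ℝ)) a
  refine ⟨fun v => ⌊g v⌋, by simp [hga], fun v hv => ?_⟩
  have h1 := hg v hv
  rw [combo_apply] at h1 ⊢
  have h2 : ∑ u, (G.mult u v : ℝ) * (g v - g u) - ∑ u, (G.mult u v : ℝ) ≤
      ∑ u, (G.mult u v : ℝ) * ((⌊g v⌋ : ℝ) - ⌊g u⌋) := by
    rw [← Finset.sum_sub_distrib]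
    refine Finset.sum_le_sum fun u _ => ?_
    rw [← mul_sub_one]
    exact mul_le_mul_of_nonneg_left (by linarith [Int.lt_floor_add_one (g v), Int.floor_le (g u)])
      (Nat.cast_nonneg _)
  linarith

/-- The real solution `g` of the corresponding equations bounds every admissible `f` from below, by
the minimum principle for `f - g`. So the integer sums are bounded below and a least one exists. -/
theorem Connected.exists_minimal_int_lt_combo_off (hG : G.Connected) (x : Fin (n + 1) → ℝ)
    (a : Fin (n + 1)) : ∃ f : Fin (n + 1) → ℤ, (f a = 0 ∧
      ∀ v, v ≠ a → x v < (G.combo fun u => (f u : ℝ) : Fin (n + 1) → ℝ) v) ∧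
      ∀ f' : Fin (n + 1) → ℤ, f' a = 0 →
        (∀ v, v ≠ a → x v < (G.combo fun u => (f' u : ℝ) : Fin (n + 1) → ℝ) v) →
        ∑ v, f v ≤ ∑ v, f' v := by
  obtain ⟨g, hga, hg⟩ := hG.exists_combo_eq_off x a
  obtain ⟨f₁, hf₁⟩ := hG.exists_int_lt_combo_off x a
  obtain ⟨_, ⟨f, hf, rfl⟩, hmin⟩ := Int.exists_least_of_bdd
    (P := fun z => ∃ f : Fin (n + 1) → ℤ, (f a = 0 ∧
      ∀ v, v ≠ a → x v < (G.combo fun u => (f u : ℝ) : Fin (n + 1) → ℝ) v) ∧ ∑ v, f v = z)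
    ⟨⌊∑ v, g v⌋, by
      rintro _ ⟨f, ⟨hfa, hf⟩, rfl⟩
      have h1 : ∀ v, g v ≤ f v := fun v => by
        have h2 := hG.le_of_combo_nonneg (f := (fun u => (f u : ℝ)) - g) (a := a) (fun u hu => by
          rw [map_sub, Submodule.coe_sub, Pi.sub_apply, hg u hu]
          linarith [hf u hu]) v
        simp only [Pi.sub_apply, hfa, hga] at h2
        push_cast at h2
        linarith
      have h3 : ((⌊∑ v, g v⌋ : ℤ) : ℝ) ≤ ((∑ v, f v : ℤ) : ℝ) := by
        push_cast
        exact (Int.floor_le _).trans (Finset.sum_le_sum fun v _ => h1 v)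
      exact_mod_cast h3⟩ ⟨_, f₁, hf₁, rfl⟩
  exact ⟨f, hf, fun f' h1 h2 => hmin _ ⟨f', ⟨h1, h2⟩, rfl⟩⟩

/-- Dhar's burning algorithm: a point that is not strictly dominated by a lattice point is
bounded below by an extremal point of some permutation. -/
theorem Connected.exists_perm_sub_sum_le (hG : G.Connected) {x : Fin (n + 1) → ℝ}
    (hx : ∀ q ∈ G.lattice, ∃ v, (q : Fin (n + 1) → ℝ) v ≤ x v) :
    ∃ σ : Equiv.Perm (Fin (n + 1)), ∃ q ∈ G.lattice, ∀ m, (q : Fin (n + 1) → ℝ) (σ m) -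
      ∑ j ∈ Finset.Iio m, (G.mult (σ j) (σ m) : ℝ) ≤ x (σ m) := by
  obtain ⟨f, ⟨hf0, hf⟩, hmin⟩ := hG.exists_minimal_int_lt_combo_off x 0
  set q := G.combo fun u => (f u : ℝ) with hq
  have hqL : q ∈ G.lattice := G.mem_lattice_iff.2 ⟨f, rfl⟩
  obtain ⟨σ, hσ⟩ := exists_perm_forall_image_Iio (n := n)
    (P := fun B v => (q : Fin (n + 1) → ℝ) v - ∑ w ∈ B, (G.mult w v : ℝ) ≤ x v) (by
    intro B hB
    by_cases h0 : (0 : Fin (n + 1)) ∈ B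
    -- Subtracting the indicator of the complement of `B` lowers the sum, so by minimality some
    -- coordinate `v ≠ 0` drops to `x v` or below. It can only drop outside `B`, and there by the
    -- number of edges from `B`.
    · let e : Fin (n + 1) → ℤ := fun v => if v ∈ B then 0 else 1
      obtain ⟨u, hu⟩ : ∃ u, u ∉ B := by
        by_contra! h
        exact hB (Finset.eq_univ_of_forall h)
      have he : 0 < ∑ v, e v := Finset.sum_pos' (fun v _ => by simp only [e]; split_ifs <;> simp)
        ⟨u, Finset.mem_univ u, by simp [e, hu]⟩
      obtain ⟨v, hv0, hv⟩ : ∃ v, v ≠ 0 ∧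
          (G.combo fun u => ((f u - e u : ℤ) : ℝ) : Fin (n + 1) → ℝ) v ≤ x v := by
        by_contra! h
        have := hmin (fun u => f u - e u) (by simp [hf0, e, h0]) h
        rw [Finset.sum_sub_distrib] at this
        linarith
      have hsub : (G.combo fun u => ((f u - e u : ℤ) : ℝ)) = q - G.combo fun u => (e u : ℝ) := by
        rw [hq, ← map_sub]
        congr 1
        ext u
        simp
      rw [hsub, Submodule.coe_sub, Pi.sub_apply, combo_apply _ fun u => (e u : ℝ)] at hv
      have hvB : v ∉ B := by
        intro hvB
        have h1 : ∑ w, (G.mult w v : ℝ) * ((e v : ℝ) - e w) ≤ 0 :=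
          Finset.sum_nonpos fun w _ => mul_nonpos_of_nonneg_of_nonpos (Nat.cast_nonneg _) (by
            simp only [e, if_pos hvB]
            split_ifs <;> simp)
        linarith [hf v hv0]
      refine ⟨v, hvB, ?_⟩
      have h2 : ∑ w, (G.mult w v : ℝ) * ((e v : ℝ) - e w) = ∑ w ∈ B, (G.mult w v : ℝ) := by
        rw [← Finset.univ_inter B, ← Finset.sum_ite_mem]
        refine Finset.sum_congr rfl fun w _ => ?_
        simp only [e, if_neg hvB]
        split_ifs <;> simp
      rwa [h2] at hv
    -- Vertex 0 can burn at any stage: `q` exceeds `x` at all other vertices but does not dominate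
    -- it strictly.
    · refine ⟨0, h0, ?_⟩
      obtain ⟨v, hv⟩ := hx q hqL
      have h1 : (q : Fin (n + 1) → ℝ) 0 ≤ x 0 := by
        by_cases hv0 : v = 0
        · rwa [hv0] at hv
        · exact absurd hv (not_le.2 (hf v hv0))
      have h2 : 0 ≤ ∑ w ∈ B, (G.mult w 0 : ℝ) := Finset.sum_nonneg fun _ _ => Nat.cast_nonneg _
      linarith)
  refine ⟨σ, q, hqL, fun m => ?_⟩
  have h := hσ m
  rwa [Finset.sum_image σ.injective.injOn] at h

variable (G)

theorem exists_apply_le_neg_sum (σ : Equiv.Perm (Fin (n + 1))) {q : H0 n} (hq : q ∈ G.lattice) :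
    ∃ m, (q : Fin (n + 1) → ℝ) (σ m) ≤ -∑ j ∈ Finset.Iio m, (G.mult (σ j) (σ m) : ℝ) := by
  obtain ⟨f, rfl⟩ := G.mem_lattice_iff.1 hq
  obtain ⟨a, ha⟩ := Finite.exists_min fun j => f (σ j)
  have hne : (Finset.univ.filter fun j => f (σ j) = f (σ a)).Nonempty := ⟨a, by simp⟩
  -- `m` is the first position in the order `σ` where `f` is minimal. Earlier values exceed it by at
  -- least 1, so each earlier edge contributes at most -1.
  set m := Finset.min' _ hne with hm
  have hma : f (σ m) = f (σ a) := (Finset.mem_filter.1 (Finset.min'_mem _ hne)).2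
  refine ⟨m, ?_⟩
  rw [combo_apply, ← Equiv.sum_comp σ, ← Finset.sum_neg_distrib,
    ← Finset.univ_inter (Finset.Iio m), ← Finset.sum_ite_mem]
  refine Finset.sum_le_sum fun j _ => ?_
  have hj : (f (σ m) : ℝ) ≤ f (σ j) := by exact_mod_cast hma.trans_le (ha j)
  have hnn : (0 : ℝ) ≤ G.mult (σ j) (σ m) := Nat.cast_nonneg _
  split_ifs with hjm
  · have h1 : f (σ m) ≠ f (σ j) := fun h =>
      absurd (Finset.min'_le _ j (Finset.mem_filter.2 ⟨Finset.mem_univ j, h.symm.trans hma⟩))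
        (not_le.2 (Finset.mem_Iio.1 hjm))
    have h2 : (f (σ m) : ℝ) + 1 ≤ f (σ j) := by
      have : f (σ m) + 1 ≤ f (σ j) := lt_of_le_of_ne (by exact_mod_cast hj) h1
      exact_mod_cast this
    nlinarith
  · exact mul_nonpos_of_nonneg_of_nonpos hnn (by linarith)

theorem partialSum_apply (σ : Equiv.Perm (Fin (n + 1))) (i m : Fin (n + 1)) :
    (G.partialSum σ i : Fin (n + 1) → ℝ) (σ m) = ∑ j, (G.mult (σ j) (σ m) : ℝ) *
      ((if m ≤ i then 1 else 0) - if j ≤ i then 1 else 0) := by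
  rw [partialSum_eq_combo, combo_apply, ← Equiv.sum_comp σ]
  simp

theorem neg_sum_le_partialSum_apply (σ : Equiv.Perm (Fin (n + 1))) (i m : Fin (n + 1)) :
    -∑ j ∈ Finset.Iio m, (G.mult (σ j) (σ m) : ℝ) ≤
      (G.partialSum σ i : Fin (n + 1) → ℝ) (σ m) := by
  rw [partialSum_apply, ← Finset.sum_neg_distrib, ← Finset.univ_inter (Finset.Iio m),
    ← Finset.sum_ite_mem]
  refine Finset.sum_le_sum fun j _ => ?_
  have hnn : (0 : ℝ) ≤ G.mult (σ j) (σ m) := Nat.cast_nonneg _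
  simp only [Finset.mem_Iio]
  split_ifs with h1 h2 h3 h3 h2 h3 h3
  all_goals first | linarith | exact absurd (lt_of_le_of_lt (by assumption) (not_le.1 h2)) h1

/-- Equality holds at the successor `m` of `i`, where `j < m` means `j ≤ i`. For the last `i` the
partial sum is zero and `m = 0` serves, with no earlier vertices. -/
theorem exists_partialSum_apply_eq (σ : Equiv.Perm (Fin (n + 1))) (i : Fin (n + 1)) :
    ∃ m, (G.partialSum σ i : Fin (n + 1) → ℝ) (σ m) =
      -∑ j ∈ Finset.Iio m, (G.mult (σ j) (σ m) : ℝ) := by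
  rcases Ioi_eq_empty_or_eq_Ici i with h | ⟨m, him, h⟩
  · have hi : i = Fin.last n := by
      by_contra hne
      exact Finset.notMem_empty (Fin.last n) (h ▸ Finset.mem_Ioi.2 (Fin.lt_last_iff_ne_last.2 hne))
    refine ⟨0, ?_⟩
    have : Finset.Iio (0 : Fin (n + 1)) = ∅ := by ext; simp
    rw [hi, partialSum_last, this]
    simp
  · have hlt : ∀ j, j < m ↔ j ≤ i := fun j => by
      have : j ∈ Finset.Ioi i ↔ j ∈ Finset.Ici m := by rw [h]
      rw [Finset.mem_Ioi, Finset.mem_Ici] at this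
      rw [← not_le, ← this, not_lt]
    refine ⟨m, ?_⟩
    rw [partialSum_apply, ← Finset.sum_neg_distrib, ← Finset.univ_inter (Finset.Iio m),
      ← Finset.sum_ite_mem]
    refine Finset.sum_congr rfl fun j _ => ?_
    simp only [Finset.mem_Iio, hlt, if_neg (not_le.2 him)]
    split_ifs <;> simp

variable {G}

/-- The local maxima of the distance to the lattice are the points `ν^σ + q`, up to a multiple of
the all-ones vector. -/
theorem Connected.exists_perm_eq_of_mem_crit (hG : G.Connected) {c : H0 n}
    (hc : c ∈ crit (regularSimplex n) (G.lattice : Set (H0 n))) :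
    ∃ σ : Equiv.Perm (Fin (n + 1)), ∃ q ∈ G.lattice, ∀ m, (q : Fin (n + 1) → ℝ) (σ m) -
      ∑ j ∈ Finset.Iio m, (G.mult (σ j) (σ m) : ℝ) = (c : Fin (n + 1) → ℝ) (σ m) -
        distToSet (regularSimplex n) (G.lattice : Set (H0 n)) c := by
  set r := distToSet (regularSimplex n) (G.lattice : Set (H0 n)) c with hr
  obtain ⟨σ, q, hq, hσ⟩ := hG.exists_perm_sub_sum_le
    (x := fun v => (c : Fin (n + 1) → ℝ) v - r) fun q hq => exists_apply_le_sub_distToSet c hq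
  refine ⟨σ, q, hq, ?_⟩
  by_contra! hne
  obtain ⟨m₀, hm₀⟩ := hne
  -- `δ` is the gap `(q - ν^σ) - (c - r·1)`, nonpositive and somewhere negative. Subtracting its
  -- mean `ε < 0` gives a direction `d` in `H0 n` along which the distance grows by at least `-t *
  -- ε`.
  let δ : Fin (n + 1) → ℝ := fun v => (q : Fin (n + 1) → ℝ) v -
    ∑ j ∈ Finset.Iio (σ.symm v), (G.mult (σ j) v : ℝ) - ((c : Fin (n + 1) → ℝ) v - r)
  have hδσ : ∀ m, δ (σ m) = (q : Fin (n + 1) → ℝ) (σ m) -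
      ∑ j ∈ Finset.Iio m, (G.mult (σ j) (σ m) : ℝ) - ((c : Fin (n + 1) → ℝ) (σ m) - r) :=
    fun m => by simp only [δ, Equiv.symm_apply_apply]
  have hδ : ∀ v, δ v ≤ 0 := fun v => by
    have := hδσ (σ.symm v)
    have h2 := hσ (σ.symm v)
    rw [Equiv.apply_symm_apply] at this h2
    linarith
  have hδ0 : δ (σ m₀) < 0 := lt_of_le_of_ne (hδ _) fun h => hm₀ (by
    rw [hδσ] at h
    linarith)
  have hn : (0 : ℝ) < n + 1 := by positivity
  set ε := (∑ v, δ v) / (n + 1) with hε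
  have hε0 : ε < 0 :=
    div_neg_of_neg_of_pos (Finset.sum_neg' (fun v _ => hδ v) ⟨σ m₀, Finset.mem_univ _, hδ0⟩) hn
  let d : H0 n := ⟨fun v => δ v - ε, by
    change ∑ v, (δ v - ε) = 0
    rw [Finset.sum_sub_distrib, Finset.sum_const, Finset.card_univ, Fintype.card_fin, nsmul_eq_mul]
    push_cast
    rw [hε, mul_div_cancel₀ _ hn.ne', sub_self]⟩
  have hd : ∀ v, (d : Fin (n + 1) → ℝ) v = δ v - ε := fun _ => rfl
  have hcont : Tendsto (fun t : ℝ => c + t • d) (𝓝[>] 0) (𝓝 c) := by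
    have : Continuous fun t : ℝ => c + t • d := by fun_prop
    simpa using (this.tendsto 0).mono_left nhdsWithin_le_nhds
  obtain ⟨t, ht, ht0, ht1⟩ := ((hcont.eventually hc).and
    (Ioc_mem_nhdsGT (zero_lt_one (α := ℝ)))).exists
  have hle : r - t * ε ≤ distToSet (regularSimplex n) (G.lattice : Set (H0 n)) (c + t • d) := by
    refine le_distToSet ⟨0, zero_mem _⟩ fun q' hq' => ?_
    obtain ⟨m, hm⟩ := G.exists_apply_le_neg_sum σ (sub_mem hq' hq)
    refine ⟨σ m, ?_⟩
    rw [Submodule.coe_sub, Pi.sub_apply] at hm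
    rw [Submodule.coe_add, Pi.add_apply, Submodule.coe_smul, Pi.smul_apply, hd, smul_eq_mul]
    have h1 := hδσ m
    -- As `t ≤ 1`, the point `c - r·1 + tδ` still lies above `q - ν^σ`, which no lattice point
    -- strictly dominates.
    have h2 : δ (σ m) ≤ t * δ (σ m) := by nlinarith [hδ (σ m)]
    linarith
  have h3 : t * ε < 0 := mul_neg_of_pos_of_neg ht0 hε0
  linarith

theorem Connected.isDelaunay (hn : 1 ≤ n) (hG : G.Connected) :
    IsDelaunay (regularSimplex n) (G.lattice : Set (H0 n)) hG.delComplex where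
  toIsTriangulation := hG.isTriangulation
  exists_simplex c hc := by
    classical
    obtain ⟨σ, q, hq, hσ⟩ := hG.exists_perm_eq_of_mem_crit hc
    refine ⟨_, G.range_partialSum_add_mem_delFaces σ hq, ?_, ?_⟩
    · rw [Finset.card_image_of_injective _ (hG.partialSum_add_injective σ q), H0.finrank_eq,
        Finset.card_univ, Fintype.card_fin]
    · intro y hy
      obtain ⟨i, -, rfl⟩ := Finset.mem_image.1 (Finset.mem_coe.1 hy)
      obtain ⟨m, hm⟩ := G.exists_partialSum_apply_eq σ i
      refine mem_frontier_dilate hn (k := σ m) (fun v => ?_) ?_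
      · have h1 := hσ (σ.symm v)
        have h2 := G.neg_sum_le_partialSum_apply σ i (σ.symm v)
        rw [Equiv.apply_symm_apply] at h1 h2
        rw [Submodule.coe_add, Pi.add_apply]
        linarith
      · have h1 := hσ m
        rw [Submodule.coe_add, Pi.add_apply, hm]
        linarith

end Multigraph

end LaplacianLattice

open LaplacianLattice in
theorem mainTheorem2 (n : ℕ) (hn : 1 ≤ n) :
    (∀ G : Multigraph n, G.Connected →
      ∃ T : Geometry.SimplicialComplex ℝ (H0 n), T.faces = G.delFaces ∧
        IsDelaunay (regularSimplex n) (G.lattice : Set (H0 n)) T) ∧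
    (∀ G₁ G₂ : Multigraph n, G₁.Connected → G₂.Connected →
      (originStar G₁.delFaces = originStar G₂.delFaces ↔ G₁.laplacian = G₂.laplacian)) ∧
    (∀ G : Multigraph n, G.Connected →
      numGraphs G.lattice ≤ numDelaunay (regularSimplex n) (G.lattice : Set (H0 n))) := by
  refine ⟨fun G hG => ⟨hG.delComplex, rfl, hG.isDelaunay hn⟩, fun G₁ G₂ _ _ => ⟨fun h => ?_,
    fun h => ?_⟩, fun G _ => ?_⟩
  · rw [Multigraph.eq_of_originStar_eq h]
  · rw [Multigraph.eq_of_laplacian_eq h]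
  · refine Set.encard_le_encard_of_injOn (f := fun G' : Multigraph n => originStar G'.delFaces) ?_
      fun _ _ _ _ h => Multigraph.eq_of_originStar_eq h
    rintro G' ⟨hG', hL⟩
    exact ⟨hG'.delComplex, hL ▸ hG'.isDelaunay hn, rfl⟩
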